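/- Let $\alpha>-1$, let $\mathbb D$ be the open unit disc and $\mathbb T$ the unit circle, and let $A^2_\alpha$ be the weighted Bergman space: the Hilbert space of holomorphic functions $f$ on $\mathbb D$ with $\int_{\mathbb D}|f(z)|^2(1-|z|^2)^\alpha\,dA(z)<\infty$, with inner product $\langle f,g\rangle=\int_{\mathbb D} f\,\overline g\,(1-|z|^2)^\alpha\,dA$. For a reproducing kernel Hilbert space $H$ of holomorphic functions on $\mathbb D$ let $$\mathrm{Mult}(H)=\{\varphi \text{ holomorphic on } \mathbb D:\ \varphi H\subseteq H\},\qquad \mathcal N^+(H)=\Big\{\frac{\gamma}{\psi}:\ \gamma,\psi\in \mathrm{Mult}(H),\ \overline{\psi H}=H\Big\},$$ the closure being taken in the norm of $H$. Let $\varphi\in\mathrm{Mult}(A^2_\alpha)$ be such that the Toeplitz (multiplication) operator $T_\varphi f=\varphi f$ on $A^2_\alpha$ is a contraction, and assume that $\varphi$ is not a constant of modulus one. Let $H^\alpha(\varphi)$ be the sub-Bergman space: the range of the defect operator $D=(I-T_\varphi T_\varphi^*)^{1/2}$, with the inner product $\langle Dx,Dy\rangle_{H^\alpha(\varphi)}=\langle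 x,y\rangle_{A^2_\alpha}$ for $x,y\in A^2_\alpha\ominus\ker D$. Then every $f\in\mathcal N^+(H^\alpha(\varphi))$ has non-tangential boundary values almost everywhere on $\mathbb T$: for almost every $\xi\in\mathbb T$ there is a number $f(\xi)\in\mathbb C$ such that, for every $M>1$, $f(z)\to f(\xi)$ as $z\to\xi$ within $\{z\in\mathbb D:\ |z-\xi|<M(1-|z|)\}$. -/

import Mathlib

open MeasureTheory Filter Topology Set Metric
open scoped ComplexConjugate Complex.UnitDisc InnerProductSpace

noncomputable section

/-! ### Holomorphic functions on the open unit disc -/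

/-- Extension by zero of a function on the open unit disc `𝔻` to all of `ℂ`. -/
def extendDisc (f : 𝔻 → ℂ) : ℂ → ℂ :=
  fun z => if h : ‖z‖ < 1 then f (Complex.UnitDisc.mk z h) else 0

/-- `f : 𝔻 → ℂ` is holomorphic. -/
def IsHolomorphicDisc (f : 𝔻 → ℂ) : Prop :=
  DifferentiableOn ℂ (extendDisc f) (ball 0 1)

@[simp]
theorem extendDisc_coe (f : 𝔻 → ℂ) (z : 𝔻) : extendDisc f (z : ℂ) = f z := by
  simp [extendDisc, z.norm_lt_one]

theorem extendDisc_mk (f : 𝔻 → ℂ) {z : ℂ} (h : ‖z‖ < 1) :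
    extendDisc f z = f (Complex.UnitDisc.mk z h) := by
  simp [extendDisc, h]

theorem extendDisc_zero : extendDisc 0 = 0 := by
  funext z; simp [extendDisc]

theorem extendDisc_add (f g : 𝔻 → ℂ) : extendDisc (f + g) = extendDisc f + extendDisc g := by
  funext z; by_cases h : ‖z‖ < 1 <;> simp [extendDisc, h]

theorem extendDisc_smul (c : ℂ) (f : 𝔻 → ℂ) : extendDisc (c • f) = c • extendDisc f := by
  funext z; by_cases h : ‖z‖ < 1 <;> simp [extendDisc, h]

/-! ### The area sub-mean value property -/

theorem circle_mean_sq_le {F : ℂ → ℂ} {z : ℂ} {R r : ℝ} (hF : DifferentiableOn ℂ F (ball z R))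
    (h0 : 0 < r) (hr : r < R) :
    ENNReal.ofReal (2 * Real.pi) * ‖F z‖ₑ ^ 2 ≤
      ∫⁻ θ in Ioo (-Real.pi) Real.pi, ‖F (circleMap z r θ)‖ₑ ^ 2 := by
  have hd : DiffContOnCl ℂ (fun w => F w ^ 2) (ball z |r|) := by
    rw [abs_of_pos h0]
    refine DifferentiableOn.diffContOnCl ?_
    rw [closure_ball z h0.ne']
    exact (hF.mono (closedBall_subset_ball hr)).pow 2
  have h1 := hd.circleAverage
  rw [Real.circleAverage_def] at h1
  have hper : Function.Periodic (fun θ : ℝ => F (circleMap z r θ) ^ 2) (2 * Real.pi) := by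
    intro θ; simp only [periodic_circleMap z r θ]
  have h2 := hper.intervalIntegral_add_eq 0 (-Real.pi)
  rw [zero_add, show -Real.pi + 2 * Real.pi = Real.pi by ring] at h2
  rw [h2, intervalIntegral.integral_of_le (by linarith [Real.pi_pos]),
    integral_Ioc_eq_integral_Ioo] at h1
  have h3 : (2 * Real.pi) • F z ^ 2
      = ∫ θ in Ioo (-Real.pi) Real.pi, F (circleMap z r θ) ^ 2 := by
    rw [← h1, smul_smul, mul_inv_cancel₀ (by positivity), one_smul]
  calc ENNReal.ofReal (2 * Real.pi) * ‖F z‖ₑ ^ 2 = ‖(2 * Real.pi) • F z ^ 2‖ₑ := by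
        rw [enorm_smul, enorm_pow, Real.enorm_of_nonneg (by positivity)]
    _ ≤ _ := by
        rw [h3]
        refine (enorm_integral_le_lintegral_enorm _).trans_eq ?_
        simp [enorm_pow]

theorem sub_mean_value {F : ℂ → ℂ} {z : ℂ} {R : ℝ} (hR : 0 < R)
    (hF : DifferentiableOn ℂ F (ball z R)) :
    ENNReal.ofReal (Real.pi * R ^ 2) * ‖F z‖ₑ ^ 2 ≤ ∫⁻ w in ball z R, ‖F w‖ₑ ^ 2 := by
  set g : ℂ → ENNReal := (ball z R).indicator (fun w => ‖F w‖ₑ ^ 2) with hg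
  have hgm : Measurable g := by
    have h1 : Measurable ((ball z R).indicator F) := by
      classical
      rw [← Set.piecewise_eq_indicator]
      exact hF.continuousOn.measurable_piecewise continuousOn_const measurableSet_ball
    have h2 : g = fun w => ‖(ball z R).indicator F w‖ₑ ^ 2 := by
      ext w; by_cases hw : w ∈ ball z R <;> simp [g, hw]
    rw [h2]; fun_prop
  rw [← lintegral_indicator measurableSet_ball, ← hg, ← lintegral_add_left_eq_self g z,
    ← Complex.lintegral_comp_polarCoord_symm, polarCoord_target, Measure.volume_eq_prod,
    ← Measure.prod_restrict, lintegral_prod]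
  · calc ENNReal.ofReal (Real.pi * R ^ 2) * ‖F z‖ₑ ^ 2
        = ∫⁻ r in Ioo 0 R, ENNReal.ofReal r * (ENNReal.ofReal (2 * Real.pi) * ‖F z‖ₑ ^ 2) := by
          rw [lintegral_mul_const _ (by fun_prop), ← ofReal_integral_eq_lintegral_ofReal, 
            ← integral_Ioc_eq_integral_Ioo, ← intervalIntegral.integral_of_le hR.le, integral_id,
            ← mul_assoc, ← ENNReal.ofReal_mul (by rw [zero_pow two_ne_zero, sub_zero]; positivity)]
          · congr 2; ring
          · exact (continuous_id.integrableOn_Icc).mono_set Ioo_subset_Icc_self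
          · exact (ae_restrict_mem measurableSet_Ioo).mono fun r hr => hr.1.le
      _ ≤ ∫⁻ r in Ioo 0 R, ∫⁻ θ in Ioo (-Real.pi) Real.pi, ENNReal.ofReal r •
            g (z + Complex.polarCoord.symm (r, θ)) := by
          refine setLIntegral_mono' measurableSet_Ioo fun r hr => ?_
          simp only [smul_eq_mul]
          rw [lintegral_const_mul' _ _ ENNReal.ofReal_ne_top]
          gcongr
          refine (circle_mean_sq_le hF hr.1 hr.2).trans_eq ?_
          refine lintegral_congr fun θ => ?_
          have h4 : z + Complex.polarCoord.symm (r, θ) = circleMap z r θ := by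
            simp [circleMap, Complex.exp_mul_I]
          have h5 : circleMap z r θ ∈ ball z R :=
            closedBall_subset_ball hr.2 (circleMap_mem_closedBall z hr.1.le θ)
          rw [h4, hg, indicator_of_mem h5]
      _ ≤ _ := lintegral_mono_set Ioo_subset_Ioi_self
  · refine Measurable.aemeasurable ?_
    have : Measurable fun p : ℝ × ℝ => (Complex.polarCoord.symm p) := by
      simp only [Complex.polarCoord_symm_apply]; fun_prop
    simp only [smul_eq_mul]
    fun_prop

/-! ### The weighted Bergman space -/

/-- The measure `(1 - |z|²)^α dA(z)` on the unit disc (viewed as a measure on `ℂ`), where `dA` is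
area measure. -/
def bergmanMeasure (α : ℝ) : Measure ℂ :=
  (volume.restrict (ball (0 : ℂ) 1)).withDensity
    (fun z => ENNReal.ofReal ((1 - ‖z‖ ^ 2) ^ α))

theorem measurable_bergmanWeight (α : ℝ) :
    Measurable (fun z : ℂ => ENNReal.ofReal ((1 - ‖z‖ ^ 2) ^ α)) := by
  fun_prop

theorem bergmanMeasure_absolutelyContinuous (α : ℝ) :
    bergmanMeasure α ≪ volume.restrict (ball (0 : ℂ) 1) :=
  withDensity_absolutelyContinuous _ _

theorem IsHolomorphicDisc.aestronglyMeasurable {f : 𝔻 → ℂ} (hf : IsHolomorphicDisc f) (α : ℝ) :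
    AEStronglyMeasurable (extendDisc f) (bergmanMeasure α) :=
  (hf.continuousOn.aestronglyMeasurable measurableSet_ball).mono_ac
    (bergmanMeasure_absolutelyContinuous α)

/-- The holomorphic functions `f` on `𝔻` with `∫_𝔻 |f(z)|² (1 - |z|²)^α dA(z) < ∞`, as a linear
space. -/
def bergmanSubmodule (α : ℝ) : Submodule ℂ (𝔻 → ℂ) where
  carrier := {f | IsHolomorphicDisc f ∧
    Integrable (fun z => ‖extendDisc f z‖ ^ 2) (bergmanMeasure α)}
  zero_mem' := by
    constructor
    · simp only [IsHolomorphicDisc, extendDisc_zero]; exact differentiableOn_const 0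
    · simp [extendDisc_zero]
  add_mem' := by
    rintro f g ⟨hf, hf2⟩ ⟨hg, hg2⟩
    refine ⟨?_, ?_⟩
    · simp only [IsHolomorphicDisc, extendDisc_add]; exact hf.add hg
    · have h1 := (memLp_two_iff_integrable_sq_norm (hf.aestronglyMeasurable α)).2 hf2
      have h2 := (memLp_two_iff_integrable_sq_norm (hg.aestronglyMeasurable α)).2 hg2
      have h3 := h1.add h2
      rw [← extendDisc_add] at h3
      exact (memLp_two_iff_integrable_sq_norm h3.1).1 h3
  smul_mem' := by
    rintro c f ⟨hf, hf2⟩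
    refine ⟨?_, ?_⟩
    · simp only [IsHolomorphicDisc, extendDisc_smul]; exact hf.const_smul c
    · have h1 := (memLp_two_iff_integrable_sq_norm (hf.aestronglyMeasurable α)).2 hf2
      have h3 := h1.const_smul c
      rw [← extendDisc_smul] at h3
      exact (memLp_two_iff_integrable_sq_norm h3.1).1 h3

/-- The weighted Bergman space `A²_α`. -/
def Bergman (α : ℝ) : Type := ↥(bergmanSubmodule α)

namespace Bergman

instance (α : ℝ) : AddCommGroup (Bergman α) := inferInstanceAs (AddCommGroup ↥(bergmanSubmodule α))

instance (α : ℝ) : Module ℂ (Bergman α) := inferInstanceAs (Module ℂ ↥(bergmanSubmodule α))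

/-- The underlying function on the disc of an element of `A²_α`. -/
def toFun {α : ℝ} : Bergman α →ₗ[ℂ] (𝔻 → ℂ) := (bergmanSubmodule α).subtype

theorem toFun_injective {α : ℝ} : Function.Injective (toFun : Bergman α → (𝔻 → ℂ)) :=
  Subtype.val_injective

theorem isHolomorphic {α : ℝ} (f : Bergman α) : IsHolomorphicDisc (toFun f) := f.2.1

theorem memLp {α : ℝ} (f : Bergman α) : MemLp (extendDisc (toFun f)) 2 (bergmanMeasure α) :=
  (memLp_two_iff_integrable_sq_norm (f.2.1.aestronglyMeasurable α)).2 f.2.2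

theorem integrable_sq {α : ℝ} (f : Bergman α) :
    Integrable (fun z => ‖extendDisc (toFun f) z‖ ^ 2) (bergmanMeasure α) := f.2.2

theorem integrable_inner {α : ℝ} (f g : Bergman α) :
    Integrable (fun z => extendDisc (toFun g) z * conj (extendDisc (toFun f) z))
      (bergmanMeasure α) := by
  have h : MemLp (fun z => conj (extendDisc (toFun f) z)) 2 (bergmanMeasure α) := by
    exact (memLp f).star
  exact (memLp g).integrable_mul h


theorem eval_bound_aux (α : ℝ) {ρ : ℝ} (hρ0 : 0 ≤ ρ) (hρ : ρ < 1) :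
    ∃ C : ENNReal, C ≠ ⊤ ∧ ∀ F : ℂ → ℂ, DifferentiableOn ℂ F (ball 0 1) → ∀ z : ℂ, ‖z‖ ≤ ρ →
      ‖F z‖ₑ ^ 2 ≤ C * ∫⁻ w, ‖F w‖ₑ ^ 2 ∂(bergmanMeasure α) := by
  set R : ℝ := (1 - ρ) / 2 with hR
  have hR0 : 0 < R := by rw [hR]; linarith
  have hpos : ∀ w ∈ closedBall (0 : ℂ) (ρ + R), 0 < 1 - ‖w‖ ^ 2 := by
    intro w hw
    rw [mem_closedBall_zero_iff] at hw
    nlinarith [norm_nonneg w]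
  have hcont : ContinuousOn (fun w : ℂ => (1 - ‖w‖ ^ 2) ^ α) (closedBall (0 : ℂ) (ρ + R)) :=
    ContinuousOn.rpow_const (by fun_prop) fun w hw => Or.inl (hpos w hw).ne'
  obtain ⟨w₀, hw₀, hmin⟩ := (isCompact_closedBall (0 : ℂ) (ρ + R)).exists_isMinOn
    ⟨0, by simp; linarith⟩ hcont
  set c : ℝ := (1 - ‖w₀‖ ^ 2) ^ α with hc
  have hc0 : 0 < c := Real.rpow_pos_of_pos (hpos w₀ hw₀) α
  have hk0 : ENNReal.ofReal c * ENNReal.ofReal (Real.pi * R ^ 2) ≠ 0 := by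
    refine mul_ne_zero ?_ ?_ <;> simp only [ne_eq, ENNReal.ofReal_eq_zero, not_le] <;> positivity
  have hkt : ENNReal.ofReal c * ENNReal.ofReal (Real.pi * R ^ 2) ≠ ⊤ :=
    ENNReal.mul_ne_top ENNReal.ofReal_ne_top ENNReal.ofReal_ne_top
  refine ⟨(ENNReal.ofReal c * ENNReal.ofReal (Real.pi * R ^ 2))⁻¹, ENNReal.inv_ne_top.2 hk0, ?_⟩
  intro F hF z hz
  rw [mul_comm, ← div_eq_mul_inv, ENNReal.le_div_iff_mul_le (Or.inl hk0) (Or.inl hkt)]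
  have hsub : ball z R ⊆ closedBall (0 : ℂ) (ρ + R) := by
    intro w hw
    rw [mem_closedBall_zero_iff]
    rw [mem_ball, dist_eq_norm] at hw
    calc ‖w‖ = ‖z + (w - z)‖ := by ring_nf
      _ ≤ ‖z‖ + ‖w - z‖ := norm_add_le _ _
      _ ≤ ρ + R := by linarith
  have hsub1 : ball z R ⊆ ball (0 : ℂ) 1 :=
    hsub.trans (closedBall_subset_ball (by rw [hR]; linarith))
  calc ‖F z‖ₑ ^ 2 * (ENNReal.ofReal c * ENNReal.ofReal (Real.pi * R ^ 2))
      = ENNReal.ofReal c * (ENNReal.ofReal (Real.pi * R ^ 2) * ‖F z‖ₑ ^ 2) := by ring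
    _ ≤ ENNReal.ofReal c * ∫⁻ w in ball z R, ‖F w‖ₑ ^ 2 := by
        gcongr; exact sub_mean_value hR0 (hF.mono hsub1)
    _ = ∫⁻ w in ball z R, ENNReal.ofReal c * ‖F w‖ₑ ^ 2 :=
        (lintegral_const_mul' _ _ ENNReal.ofReal_ne_top).symm
    _ ≤ ∫⁻ w in ball z R, ENNReal.ofReal ((1 - ‖w‖ ^ 2) ^ α) * ‖F w‖ₑ ^ 2 := by
        refine setLIntegral_mono' measurableSet_ball fun w hw => ?_
        gcongr
        exact hmin (hsub hw)
    _ ≤ ∫⁻ w in ball 0 1, ENNReal.ofReal ((1 - ‖w‖ ^ 2) ^ α) * ‖F w‖ₑ ^ 2 :=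
        lintegral_mono_set hsub1
    _ = _ := by
        rw [bergmanMeasure, lintegral_withDensity_eq_lintegral_mul_non_measurable _
          (measurable_bergmanWeight α) (by simp)]
        rfl

/-- The inner product `⟪f, g⟫ = ∫_𝔻 g conj(f) (1 - |z|²)^α dA`, conjugate-linear in the first
argument. -/
@[reducible]
def core (α : ℝ) : InnerProductSpace.Core ℂ (Bergman α) where
  inner f g := ∫ z, extendDisc (toFun g) z * conj (extendDisc (toFun f) z) ∂(bergmanMeasure α)
  conj_inner_symm f g := by
    rw [← integral_conj]
    congr 1; ext z; simp [mul_comm]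
  re_inner_nonneg f := by
    simp only [Complex.mul_conj]
    rw [integral_complex_ofReal]
    exact_mod_cast integral_nonneg fun z => Complex.normSq_nonneg _
  add_left f g h := by
    rw [← integral_add (integrable_inner f h) (integrable_inner g h)]
    congr 1; ext z; simp [extendDisc_add, mul_add]
  smul_left f g c := by
    rw [← integral_const_mul]
    congr 1; ext z; simp [extendDisc_smul]; ring
  definite f hf := by
    apply toFun_injective
    funext z
    have h0 : ∫ w, ‖extendDisc (toFun f) w‖ ^ 2 ∂(bergmanMeasure α) = 0 := by
      have h1 : ∀ w, extendDisc (toFun f) w * conj (extendDisc (toFun f) w)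
          = ((‖extendDisc (toFun f) w‖ ^ 2 : ℝ) : ℂ) := fun w => by
        rw [Complex.mul_conj, Complex.normSq_eq_norm_sq]
      have h2 : ∫ w, extendDisc (toFun f) w * conj (extendDisc (toFun f) w)
          ∂(bergmanMeasure α) = 0 := hf
      simp only [h1] at h2
      rw [integral_complex_ofReal] at h2
      exact_mod_cast h2
    have h3 : ∫⁻ w, ‖extendDisc (toFun f) w‖ₑ ^ 2 ∂(bergmanMeasure α) = 0 := by
      have h4 : ∀ w, ‖extendDisc (toFun f) w‖ₑ ^ 2
          = ENNReal.ofReal (‖extendDisc (toFun f) w‖ ^ 2) := fun w => by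
        rw [ENNReal.ofReal_pow (norm_nonneg _), ofReal_norm]
      simp only [h4]
      rw [← ofReal_integral_eq_lintegral_ofReal (integrable_sq f) (ae_of_all _ fun w => by positivity)]
      exact (congrArg ENNReal.ofReal h0).trans ENNReal.ofReal_zero
    obtain ⟨C, -, hC⟩ := eval_bound_aux α (norm_nonneg (z : ℂ)) z.norm_lt_one
    have h5 := hC _ (isHolomorphic f) z le_rfl
    rw [h3, mul_zero] at h5
    simpa using h5

instance (α : ℝ) : NormedAddCommGroup (Bergman α) := (core α).toNormedAddCommGroup

instance (α : ℝ) : InnerProductSpace ℂ (Bergman α) := InnerProductSpace.ofCore (core α).toCore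

theorem inner_def {α : ℝ} (f g : Bergman α) :
    ⟪f, g⟫_ℂ = ∫ z, extendDisc (toFun g) z * conj (extendDisc (toFun f) z) ∂(bergmanMeasure α) :=
  rfl

/-- The inclusion of `A²_α` in `L²`. -/
def toL2 (α : ℝ) : Bergman α →ₗᵢ[ℂ] Lp ℂ 2 (bergmanMeasure α) :=
  LinearMap.isometryOfInner
    { toFun := fun f => (memLp f).toLp _
      map_add' := fun f g => by
        rw [← MemLp.toLp_add]; congr 1; rw [map_add, extendDisc_add]
      map_smul' := fun c f => by
        rw [RingHom.id_apply, ← MemLp.toLp_const_smul]; congr 1; rw [map_smul, extendDisc_smul] }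
    (fun f g => by
      rw [L2.inner_def, inner_def]
      refine integral_congr_ae ?_
      filter_upwards [(memLp f).coeFn_toLp, (memLp g).coeFn_toLp] with z h1 h2
      simp only [LinearMap.coe_mk, AddHom.coe_mk, h1, h2]
      simp)

theorem coeFn_toL2 {α : ℝ} (f : Bergman α) :
    toL2 α f =ᵐ[bergmanMeasure α] extendDisc (toFun f) := (memLp f).coeFn_toLp

theorem lintegral_sq {α : ℝ} (f : Bergman α) :
    ∫⁻ w, ‖extendDisc (toFun f) w‖ₑ ^ 2 ∂(bergmanMeasure α) = ‖f‖ₑ ^ 2 := by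
  have h4 : ∀ w, ‖extendDisc (toFun f) w‖ₑ ^ 2
      = ENNReal.ofReal (‖extendDisc (toFun f) w‖ ^ 2) := fun w => by
    rw [ENNReal.ofReal_pow (norm_nonneg _), ofReal_norm]
  simp only [h4]
  rw [← ofReal_integral_eq_lintegral_ofReal (integrable_sq f) (ae_of_all _ fun w => by positivity),
    ← ofReal_norm, ← ENNReal.ofReal_pow (norm_nonneg _)]
  congr 1
  have h1 : ((‖f‖ ^ 2 : ℝ) : ℂ) = ⟪f, f⟫_ℂ := by rw [inner_self_eq_norm_sq_to_K]; norm_cast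
  rw [inner_def] at h1
  simp only [Complex.mul_conj, Complex.normSq_eq_norm_sq] at h1
  rw [integral_complex_ofReal] at h1
  exact_mod_cast h1.symm

theorem eval_bound (α : ℝ) {ρ : ℝ} (hρ0 : 0 ≤ ρ) (hρ : ρ < 1) :
    ∃ C : ℝ, ∀ f : Bergman α, ∀ z : 𝔻, ‖(z : ℂ)‖ ≤ ρ → ‖toFun f z‖ ≤ C * ‖f‖ := by
  obtain ⟨C, hCt, hC⟩ := eval_bound_aux α hρ0 hρ
  refine ⟨√C.toReal, fun f z hz => ?_⟩
  have h := hC _ (isHolomorphic f) z hz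
  rw [lintegral_sq, extendDisc_coe] at h
  have h2 := ENNReal.toReal_mono (ENNReal.mul_ne_top hCt (by simp)) h
  simp only [ENNReal.toReal_pow, ENNReal.toReal_mul, toReal_enorm] at h2
  rw [← abs_of_nonneg (norm_nonneg (toFun f z)), ← abs_of_nonneg (norm_nonneg f)]
  rw [← Real.sqrt_sq_eq_abs, ← Real.sqrt_sq_eq_abs, ← Real.sqrt_mul ENNReal.toReal_nonneg]
  exact Real.sqrt_le_sqrt h2

instance (α : ℝ) : RKHS ℂ (Bergman α) 𝔻 ℂ where
  coeCLM :=
    { (toFun : Bergman α →ₗ[ℂ] (𝔻 → ℂ)) with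
      cont := by
        refine continuous_pi fun z => ?_
        obtain ⟨C, hC⟩ := eval_bound α (norm_nonneg (z : ℂ)) z.norm_lt_one
        exact AddMonoidHomClass.continuous_of_bound
          ((LinearMap.proj z).comp (toFun : Bergman α →ₗ[ℂ] (𝔻 → ℂ))) C fun f => hC f z le_rfl }
  coeCLM_injective := toFun_injective

instance (α : ℝ) : CompleteSpace (Bergman α) := by
  refine Metric.complete_of_cauchySeq_tendsto fun u hu => ?_
  have huL : CauchySeq fun n => toL2 α (u n) := (toL2 α).isometry.uniformContinuous.comp_cauchySeq hu
  obtain ⟨G, hG⟩ := cauchySeq_tendsto_of_complete huL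
  have hunif : ∀ ρ : ℝ, 0 ≤ ρ → ρ < 1 →
      UniformCauchySeqOn (fun n => extendDisc (toFun (u n))) atTop (closedBall 0 ρ) := by
    intro ρ h0 h1
    obtain ⟨C, hC⟩ := eval_bound α h0 h1
    rw [Metric.uniformCauchySeqOn_iff]
    intro ε hε
    obtain ⟨N, hN⟩ := Metric.cauchySeq_iff.1 hu (ε / (|C| + 1)) (by positivity)
    refine ⟨N, fun m hm n hn w hw => ?_⟩
    rw [mem_closedBall_zero_iff] at hw
    have hw1 : ‖w‖ < 1 := hw.trans_lt h1
    have h2 := hC (u m - u n) (Complex.UnitDisc.mk w hw1) (by simpa using hw)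
    rw [map_sub, Pi.sub_apply] at h2
    rw [extendDisc_mk _ hw1, extendDisc_mk _ hw1, dist_eq_norm]
    have h3 := hN m hm n hn
    rw [dist_eq_norm, lt_div_iff₀ (by positivity)] at h3
    nlinarith [norm_nonneg (u m - u n), le_abs_self C]
  have hpt : ∀ z : 𝔻, ∃ c, Tendsto (fun n => toFun (u n) z) atTop (𝓝 c) := by
    intro z
    have h1 := (hunif ‖(z : ℂ)‖ (norm_nonneg _) z.norm_lt_one).cauchySeq (x := (z : ℂ)) (by simp)
    simp only [extendDisc_coe] at h1
    exact cauchySeq_tendsto_of_complete h1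
  choose g hg using hpt
  have hgt : ∀ w ∈ ball (0 : ℂ) 1,
      Tendsto (fun n => extendDisc (toFun (u n)) w) atTop (𝓝 (extendDisc g w)) := by
    intro w hw
    rw [mem_ball_zero_iff] at hw
    simp only [extendDisc_mk _ hw]
    exact hg _
  have hloc : TendstoLocallyUniformlyOn (fun n => extendDisc (toFun (u n))) (extendDisc g) atTop
      (ball 0 1) := by
    rw [tendstoLocallyUniformlyOn_iff_forall_isCompact isOpen_ball]
    intro K hK hKc
    obtain ⟨ρ, h0, h1, h2⟩ : ∃ ρ : ℝ, 0 ≤ ρ ∧ ρ < 1 ∧ K ⊆ closedBall (0 : ℂ) ρ := by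
      rcases K.eq_empty_or_nonempty with rfl | hne
      · exact ⟨0, le_rfl, one_pos, empty_subset _⟩
      · obtain ⟨w, hw, hmax⟩ := hKc.exists_isMaxOn hne continuous_norm.continuousOn
        exact ⟨‖w‖, norm_nonneg _, by simpa using hK hw,
          fun v hv => by simpa using hmax hv⟩
    exact ((hunif ρ h0 h1).tendstoUniformlyOn_of_tendsto fun w hw =>
      hgt w (closedBall_subset_ball h1 hw)).mono h2
  have hghol : IsHolomorphicDisc g :=
    hloc.differentiableOn (Eventually.of_forall fun n => isHolomorphic (u n)) isOpen_ball
  have hGg : (G : ℂ → ℂ) =ᵐ[bergmanMeasure α] extendDisc g := by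
    obtain ⟨ns, hns, hae⟩ := (tendstoInMeasure_of_tendsto_Lp hG).exists_seq_tendsto_ae
    have hball : ∀ᵐ w ∂(bergmanMeasure α), w ∈ ball (0 : ℂ) 1 :=
      (bergmanMeasure_absolutelyContinuous α).ae_le (ae_restrict_mem measurableSet_ball)
    have hco : ∀ᵐ w ∂(bergmanMeasure α), ∀ n, toL2 α (u n) w = extendDisc (toFun (u n)) w :=
      ae_all_iff.2 fun n => coeFn_toL2 (u n)
    filter_upwards [hae, hball, hco] with w h1 h2 h3
    simp only [h3] at h1
    exact tendsto_nhds_unique h1 ((hgt w h2).comp hns.tendsto_atTop)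
  have hgL : MemLp (extendDisc g) 2 (bergmanMeasure α) := (memLp_congr_ae hGg).1 (Lp.memLp G)
  let h : Bergman α := ⟨g, hghol, (memLp_two_iff_integrable_sq_norm hgL.1).1 hgL⟩
  refine ⟨h, ?_⟩
  have hhG : toL2 α h = G := Lp.ext ((coeFn_toL2 h).trans hGg.symm)
  rw [← hhG] at hG
  exact (toL2 α).isometry.isEmbedding.tendsto_nhds_iff.2 hG

end Bergman

/-! ### The range space of an operator and the defect operator -/

section OperatorRange

variable {E : Type*} [NormedAddCommGroup E] [InnerProductSpace ℂ E]

/-- The range of a bounded operator `D` on a Hilbert space, to be equipped with the inner product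
`⟪D x, D y⟫ = ⟪x, y⟫` for `x, y ∈ (ker D)ᗮ`. -/
def OperatorRange (D : E →L[ℂ] E) : Type _ := ↥(LinearMap.range (D : E →ₗ[ℂ] E))

namespace OperatorRange

variable (D : E →L[ℂ] E)

instance : AddCommGroup (OperatorRange D) :=
  inferInstanceAs (AddCommGroup ↥(LinearMap.range (D : E →ₗ[ℂ] E)))

instance : Module ℂ (OperatorRange D) :=
  inferInstanceAs (Module ℂ ↥(LinearMap.range (D : E →ₗ[ℂ] E)))

/-- The inclusion of the range of `D` in `E`. -/
def incl : OperatorRange D →ₗ[ℂ] E := (LinearMap.range (D : E →ₗ[ℂ] E)).subtype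

theorem incl_injective : Function.Injective (incl D) := Subtype.val_injective

/-- `D`, as a map onto its range. -/
def proj : E →ₗ[ℂ] OperatorRange D := (D : E →ₗ[ℂ] E).rangeRestrict

@[simp]
theorem incl_proj (x : E) : incl D (proj D x) = D x := rfl

variable [CompleteSpace E]

theorem proj_bijective :
    Function.Bijective ((proj D).comp ((LinearMap.ker (D : E →ₗ[ℂ] E))ᗮ).subtype) := by
  have hc : IsClosed ((LinearMap.ker (D : E →ₗ[ℂ] E) : Submodule ℂ E) : Set E) :=
    D.isClosed_ker
  have : CompleteSpace (LinearMap.ker (D : E →ₗ[ℂ] E)) := hc.completeSpace_coe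
  constructor
  · rw [← LinearMap.ker_eq_bot, LinearMap.ker_eq_bot']
    rintro ⟨x, hx⟩ h
    have h1 : D x = 0 := by
      have := congrArg (incl D) h
      simpa using this
    have h2 : ⟪x, x⟫_ℂ = 0 := hx x h1
    simpa using h2
  · intro u
    obtain ⟨x, hx⟩ : ∃ x, D x = incl D u := u.2
    refine ⟨⟨x - (LinearMap.ker (D : E →ₗ[ℂ] E)).starProjection x, ?_⟩, ?_⟩
    · exact Submodule.sub_starProjection_mem_orthogonal x
    · apply incl_injective
      have h3 : D ((LinearMap.ker (D : E →ₗ[ℂ] E)).starProjection x) = 0 :=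
        (Submodule.starProjection_apply_mem _ x : _ ∈ LinearMap.ker (D : E →ₗ[ℂ] E))
      simp [h3, hx]

/-- The inverse of the bijection `D : (ker D)ᗮ → range D`. -/
def lift : OperatorRange D ≃ₗ[ℂ] ↥((LinearMap.ker (D : E →ₗ[ℂ] E))ᗮ) :=
  (LinearEquiv.ofBijective _ (proj_bijective D)).symm

theorem apply_lift (u : OperatorRange D) : D (lift D u) = incl D u :=
  congrArg (incl D) ((LinearEquiv.ofBijective _ (proj_bijective D)).apply_symm_apply u)

theorem lift_proj (x : ↥((LinearMap.ker (D : E →ₗ[ℂ] E))ᗮ)) : lift D (proj D x) = x :=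
  (LinearEquiv.ofBijective _ (proj_bijective D)).symm_apply_apply x

/-- The inner product on the range of `D`. -/
@[reducible]
def core : InnerProductSpace.Core ℂ (OperatorRange D) where
  inner u v := ⟪(lift D u : E), (lift D v : E)⟫_ℂ
  conj_inner_symm u v := inner_conj_symm _ _
  re_inner_nonneg u := inner_self_nonneg (𝕜 := ℂ) (x := (lift D u : E))
  add_left u v w := by simp only [map_add, Submodule.coe_add, inner_add_left]
  smul_left u v c := by simp only [map_smul, Submodule.coe_smul, inner_smul_left]
  definite u hu := by
    have h : (lift D u : E) = 0 := inner_self_eq_zero.1 hu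
    simpa using h

instance : NormedAddCommGroup (OperatorRange D) := (core D).toNormedAddCommGroup

instance : InnerProductSpace ℂ (OperatorRange D) := InnerProductSpace.ofCore (core D).toCore

/-- `⟪D x, D y⟫ = ⟪x, y⟫` for `x, y ∈ (ker D)ᗮ`. -/
theorem inner_proj_proj (x y : ↥((LinearMap.ker (D : E →ₗ[ℂ] E))ᗮ)) :
    ⟪proj D (x : E), proj D (y : E)⟫_ℂ = ⟪(x : E), (y : E)⟫_ℂ := by
  change ⟪(lift D (proj D x) : E), (lift D (proj D y) : E)⟫_ℂ = _
  rw [lift_proj, lift_proj]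

/-- The range of `D` is isometric to `(ker D)ᗮ`. -/
def liftIsometry : OperatorRange D ≃ₗᵢ[ℂ] ↥((LinearMap.ker (D : E →ₗ[ℂ] E))ᗮ) :=
  LinearEquiv.isometryOfInner (lift D) fun _ _ => rfl

instance : CompleteSpace (OperatorRange D) :=
  (completeSpace_congr (e := (liftIsometry D).toEquiv)
    (liftIsometry D).isometry.isUniformEmbedding).2 inferInstance

/-- If `E` is a reproducing kernel Hilbert space, then so is the range of `D`. -/
instance {X : Type*} [RKHS ℂ E X ℂ] : RKHS ℂ (OperatorRange D) X ℂ where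
  coeCLM :=
    { (RKHS.coeCLM ℂ : E →L[ℂ] X → ℂ).toLinearMap.comp (incl D) with
      cont := by
        have h : (fun u => (RKHS.coeCLM ℂ : E →L[ℂ] X → ℂ) (incl D u)) = fun u =>
            (RKHS.coeCLM ℂ : E →L[ℂ] X → ℂ) (D (liftIsometry D u : E)) := by
          funext u
          exact congrArg _ (apply_lift D u).symm
        change Continuous fun u => (RKHS.coeCLM ℂ : E →L[ℂ] X → ℂ) (incl D u)
        rw [h]
        have h2 := (liftIsometry D).continuous
        fun_prop }
  coeCLM_injective := RKHS.coeCLM_injective.comp (incl_injective D)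

end OperatorRange

/-- The defect operator `(I - T T*)^{1/2}` of a contraction `T`. -/
def defectOperator [CompleteSpace E] (T : E →L[ℂ] E) : E →L[ℂ] E :=
  CFC.sqrt (1 - T * ContinuousLinearMap.adjoint T)

end OperatorRange

/-! ### Multipliers and the Smirnov class of a reproducing kernel Hilbert space on the disc -/

section Smirnov

variable (H : Type*) [NormedAddCommGroup H] [InnerProductSpace ℂ H] [RKHS ℂ H 𝔻 ℂ]

/-- `Mult(H)`: the holomorphic functions `φ` on `𝔻` with `φ H ⊆ H`. -/
def Mult : Set (𝔻 → ℂ) :=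
  {φ | IsHolomorphicDisc φ ∧ ∀ h : H, ∃ g : H, (g : 𝔻 → ℂ) = φ * h}

/-- The Smirnov class `N⁺(H)`: quotients `γ / ψ` of multipliers of `H` such that `ψ H` is dense
in `H`. -/
def smirnovClass : Set (𝔻 → ℂ) :=
  {f | ∃ γ ∈ Mult H, ∃ ψ ∈ Mult H,
    Dense {g : H | ∃ h : H, (g : 𝔻 → ℂ) = ψ * h} ∧ f = γ / ψ}

variable {H}

theorem exists_mul_mem {φ : 𝔻 → ℂ} (hφ : φ ∈ Mult H) (h : H) :
    ∃ g : H, (g : 𝔻 → ℂ) = φ * h := hφ.2 h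

/-- The linear map `h ↦ φ h` on `H`, for a multiplier `φ` of `H`. -/
def multiplicationLinearMap (φ : 𝔻 → ℂ) (hφ : φ ∈ Mult H) : H →ₗ[ℂ] H where
  toFun h := (exists_mul_mem hφ h).choose
  map_add' h k := by
    apply DFunLike.coe_injective
    refine (exists_mul_mem hφ (h + k)).choose_spec.trans ?_
    rw [RKHS.coe_add, RKHS.coe_add, mul_add, (exists_mul_mem hφ h).choose_spec,
      (exists_mul_mem hφ k).choose_spec]
  map_smul' c h := by
    apply DFunLike.coe_injective
    refine (exists_mul_mem hφ (c • h)).choose_spec.trans ?_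
    rw [RingHom.id_apply, RKHS.coe_smul, RKHS.coe_smul, mul_smul_comm,
      (exists_mul_mem hφ h).choose_spec]

theorem multiplicationLinearMap_apply (φ : 𝔻 → ℂ) (hφ : φ ∈ Mult H) (h : H) (z : 𝔻) :
    multiplicationLinearMap φ hφ h z = φ z * h z :=
  congrFun (exists_mul_mem hφ h).choose_spec z

/-- The operator `h ↦ φ h` on `H`, for a multiplier `φ` of `H`; it is bounded by the closed graph
theorem. -/
def multiplicationOperator [CompleteSpace H] (φ : 𝔻 → ℂ) (hφ : φ ∈ Mult H) : H →L[ℂ] H :=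
  ContinuousLinearMap.ofSeqClosedGraph (g := multiplicationLinearMap φ hφ)
    (fun u x y hu hTu => by
      apply DFunLike.coe_injective
      funext z
      have h1 := ((RKHS.continuous_eval (H := H) z).tendsto y).comp hTu
      have h2 := (((RKHS.continuous_eval (H := H) z).tendsto x).comp hu).const_mul (φ z)
      refine tendsto_nhds_unique h1 ?_
      rw [multiplicationLinearMap_apply]
      exact h2.congr fun n => (multiplicationLinearMap_apply φ hφ (u n) z).symm)

theorem multiplicationOperator_apply [CompleteSpace H] (φ : 𝔻 → ℂ) (hφ : φ ∈ Mult H) (h : H)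
    (z : 𝔻) : multiplicationOperator φ hφ h z = φ z * h z :=
  multiplicationLinearMap_apply φ hφ h z

end Smirnov

/-! ### Sub-Bergman spaces -/

/-- The Toeplitz operator `T_φ` on `A²_α` with holomorphic symbol `φ ∈ Mult(A²_α)`, which is
multiplication by `φ`. -/
abbrev toeplitz (α : ℝ) (φ : 𝔻 → ℂ) (hφ : φ ∈ Mult (Bergman α)) : Bergman α →L[ℂ] Bergman α :=
  multiplicationOperator φ hφ

/-- The sub-Bergman space `H^α(φ)`: the range of `(I - T_φ T_φ*)^{1/2}`, with the inner product of
`OperatorRange`. -/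
abbrev SubBergman (α : ℝ) (φ : 𝔻 → ℂ) (hφ : φ ∈ Mult (Bergman α)) : Type :=
  OperatorRange (defectOperator (toeplitz α φ hφ))

/-! ### Non-tangential limits -/

/-- The non-tangential approach region `{z ∈ 𝔻 : |z - ξ| < M (1 - |z|)}` at `ξ`. -/
def approachRegion (ξ : ℂ) (M : ℝ) : Set 𝔻 :=
  {z | ‖(z : ℂ) - ξ‖ < M * (1 - ‖(z : ℂ)‖)}

/-- `f(z) → L` as `z → ξ` within every non-tangential approach region at `ξ`. -/
def HasNontangentialLimit (f : 𝔻 → ℂ) (ξ L : ℂ) : Prop :=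
  ∀ M : ℝ, 1 < M →
    Tendsto f (comap (fun z : 𝔻 => (z : ℂ)) (𝓝 ξ) ⊓ 𝓟 (approachRegion ξ M)) (𝓝 L)

end

/-! ### Fatou's theorem for bounded holomorphic functions -/

section Fatou

open Real (circleAverage)

/-! The quotient `γ / ψ` is a quotient of bounded holomorphic functions with zero-free denominator,
so the claim reduces to two classical boundary facts.

The kernel `k` at `z` satisfies `T* k = conj (φ z) • k`, so `D² k = (I - T T*) k` takes the value
`(1 - |φ z|²) ‖k‖²` at `z`. This is positive, since `|φ| < 1` by the maximum principle. Hence the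
functions in `H^α(φ)` have no common zero (`exists_subBergman_apply_ne_zero`). It follows that
multipliers are bounded by their operator norm (`norm_mult_apply_le`), and that density of `ψ H`
prevents `ψ` from vanishing (`ne_zero_of_dense_mul`).

Fatou's theorem (`ae_exists_tendsto_nontangential`) is proved through a primitive `F` of the bounded
function. It is Lipschitz, so `θ ↦ F (e^{iθ})` is differentiable almost everywhere. At such a point
`ξ`, subtracting the first-order part of `F` leaves `G = o(|ζ - ξ|)` on the circle. The derivative
of `G` is an average of `G` against a kernel of size `(1 - |z|²) / |ζ - z|³`, and this forces it to
tend to `0` non-tangentially.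

The boundary values of `ψ` are nonzero almost everywhere (`ae_not_tendsto_zero_of_ne_zero`): the
mean of `log |ψ|` over each circle is `log |ψ 0|`, and Fatou's lemma then prevents `log |ψ|` from
tending to `-∞` on a set of positive measure. -/

theorem norm_circleAverage_le_of_norm_le {u : ℂ → ℂ} {g : ℂ → ℝ} {c : ℂ} {R : ℝ}
    (hg : CircleIntegrable g c R) (h : ∀ ζ ∈ sphere c |R|, ‖u ζ‖ ≤ g ζ) :
    ‖circleAverage u c R‖ ≤ circleAverage g c R := by
  rw [Real.circleAverage_def, Real.circleAverage_def, norm_smul, smul_eq_mul, Real.norm_eq_abs,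
    abs_of_pos (inv_pos.2 Real.two_pi_pos)]
  gcongr
  exact intervalIntegral.norm_integral_le_of_norm_le Real.two_pi_pos.le
    (ae_of_all _ fun θ _ => h _ (circleMap_mem_sphere' c R θ)) hg

/-- Poisson's formula for the constant function `1`. -/
theorem circleAverage_poissonKernel_eq_one {z : ℂ} (hz : z ∈ ball (0 : ℂ) 1) :
    circleAverage (fun ζ => (1 - ‖z‖ ^ 2) / ‖ζ - z‖ ^ 2) 0 1 = 1 := by
  have h := (diffContOnCl_const (𝕜 := ℂ) (s := ball (0 : ℂ) 1)
    (c := (1 : ℂ))).circleAverage_poissonKernel_smul' hz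
  have h2 : circleAverage (fun ζ : ℂ => (((1 - ‖z‖ ^ 2) / ‖ζ - z‖ ^ 2 : ℝ) : ℂ)) 0 1 = 1 := by
    rw [← h]
    refine Real.circleAverage_congr_sphere fun ζ hζ => ?_
    have : ‖ζ‖ = 1 := by simpa using hζ
    simp [this]
  rw [Real.circleAverage_def, intervalIntegral.integral_ofReal] at h2
  rw [Real.circleAverage_def]
  have h3 := congrArg Complex.re h2
  simpa using h3

/-! ### The derivative as an average of boundary values. -/

theorem sub_ne_zero_of_mem_sphere_of_mem_ball {z ζ : ℂ} (hz : z ∈ ball (0 : ℂ) 1)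
    (hζ : ζ ∈ sphere (0 : ℂ) 1) : ζ - z ≠ 0 := by
  rw [mem_ball_zero_iff] at hz
  rw [mem_sphere_zero_iff_norm] at hζ
  intro h
  rw [sub_eq_zero.1 h] at hζ
  linarith

theorem norm_one_sub_conj_mul {z ζ : ℂ} (hζ : ζ ∈ sphere (0 : ℂ) 1) :
    ‖1 - conj z * ζ‖ = ‖ζ - z‖ := by
  rw [mem_sphere_zero_iff_norm] at hζ
  have h1 : 1 - conj z * ζ = ζ * conj (ζ - z) := by
    have : ζ * conj ζ = 1 := by rw [Complex.mul_conj, Complex.normSq_eq_norm_sq, hζ]; simp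
    rw [map_sub, mul_sub, this]; ring
  rw [h1, norm_mul, hζ, one_mul, RCLike.norm_conj]

theorem one_sub_conj_mul_ne_zero {z ζ : ℂ} (hz : z ∈ ball (0 : ℂ) 1)
    (hζ : ‖ζ‖ ≤ 1) : 1 - conj z * ζ ≠ 0 := by
  rw [mem_ball_zero_iff] at hz
  intro h
  have h1 : ‖conj z * ζ‖ = 1 := by rw [← sub_eq_zero.1 h]; simp
  rw [norm_mul, RCLike.norm_conj] at h1
  nlinarith [norm_nonneg z, norm_nonneg ζ]

/-- The kernel representing the derivative of a holomorphic function by its boundary values. It is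
the derivative of the Cauchy kernel, minus an antianalytic term which makes it decay like the
derivative of the Poisson kernel. -/
noncomputable def derivKernel (z ζ : ℂ) : ℂ := 1 / (ζ - z) ^ 2 - conj z ^ 2 / (1 - conj z * ζ) ^ 2

/-- The numerator over the common denominator is a difference of squares. One factor is exactly `1 -
|z|²`; the other is at most `2 |ζ - z|`, because `|1 - conj z * ζ| = |ζ - z|` on the circle. -/
theorem norm_derivKernel_le {z ζ : ℂ} (hz : z ∈ ball (0 : ℂ) 1) (hζ : ζ ∈ sphere (0 : ℂ) 1) :
    ‖derivKernel z ζ‖ ≤ 2 * (1 - ‖z‖ ^ 2) / ‖ζ - z‖ ^ 3 := by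
  have h1 := sub_ne_zero_of_mem_sphere_of_mem_ball hz hζ
  have hζ1 : ‖ζ‖ = 1 := by simpa using hζ
  have h2 := one_sub_conj_mul_ne_zero hz hζ1.le
  have hz1 : ‖z‖ < 1 := by simpa using hz
  have hzz : conj z * z = ((‖z‖ ^ 2 : ℝ) : ℂ) := by
    rw [mul_comm, Complex.mul_conj, Complex.normSq_eq_norm_sq]
  have h3 : derivKernel z ζ = ((1 - conj z * ζ) - conj z * (ζ - z)) * ((1 - ‖z‖ ^ 2 : ℝ) : ℂ) /
      ((ζ - z) ^ 2 * (1 - conj z * ζ) ^ 2) := by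
    rw [derivKernel, Complex.ofReal_sub, ← hzz]
    rw [div_sub_div _ _ (pow_ne_zero 2 h1) (pow_ne_zero 2 h2)]
    push_cast
    ring
  have hp : 0 < ‖ζ - z‖ := norm_pos_iff.2 h1
  have hd : 0 ≤ 1 - ‖z‖ ^ 2 := by nlinarith [norm_nonneg z]
  rw [h3, norm_div, norm_mul, norm_mul, norm_pow, norm_pow, norm_one_sub_conj_mul hζ,
    Complex.norm_real, Real.norm_of_nonneg hd]
  have h4 : ‖(1 - conj z * ζ) - conj z * (ζ - z)‖ ≤ 2 * ‖ζ - z‖ := by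
    refine (norm_sub_le _ _).trans ?_
    rw [norm_one_sub_conj_mul hζ, norm_mul, RCLike.norm_conj]
    nlinarith
  rw [div_le_div_iff₀ (by positivity) (by positivity)]
  calc _ ≤ (2 * ‖ζ - z‖) * (1 - ‖z‖ ^ 2) * ‖ζ - z‖ ^ 3 := by gcongr
    _ = _ := by ring

theorem hasDerivAt_circleAverage_derivKernel {G : ℂ → ℂ}
    (hG : DiffContOnCl ℂ G (ball 0 1)) {z : ℂ} (hz : z ∈ ball (0 : ℂ) 1) :
    HasDerivAt G (circleAverage (fun ζ => ζ * derivKernel z ζ * G ζ) 0 1) z := by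
  have hc : ContinuousOn G (closedBall 0 1) := by
    rw [← closure_ball (0 : ℂ) one_ne_zero]; exact hG.2
  have hcs : ContinuousOn G (sphere 0 1) := hc.mono sphere_subset_closedBall
  have hint : CircleIntegrable G 0 1 := hcs.circleIntegrable zero_le_one
  have h1 := hasDerivAt_circleAverage_herglotzRieszKernel_smul hint hz
  -- The Herglotz kernel is `2ζ / (ζ - w) - 1`: Cauchy's formula handles the first term, the mean
  -- value property the second.
  have h2 : ∀ w ∈ ball (0 : ℂ) 1,
      circleAverage (fun ζ => herglotzRieszKernel 0 w ζ • G ζ) 0 1 = 2 * G w - G 0 := by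
    intro w hw
    have ha := DiffContOnCl.circleAverage_smul_div (R := 1) (by simpa using hG) (w := w)
      (by simpa using hw)
    have hb := DiffContOnCl.circleAverage (R := 1) (f := G) (c := 0) (by simpa using hG)
    have hi : CircleIntegrable (fun ζ => (2 : ℂ) • (((ζ - 0) / (ζ - w)) • G ζ)) 0 1 := by
      refine ContinuousOn.circleIntegrable zero_le_one ?_
      have : ∀ ζ ∈ sphere (0 : ℂ) 1, ζ - w ≠ 0 := fun ζ hζ =>
        sub_ne_zero_of_mem_sphere_of_mem_ball hw hζ
      fun_prop (disch := assumption)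
    rw [← ha, ← hb, ← smul_eq_mul, ← Real.circleAverage_fun_smul,
      ← Real.circleAverage_fun_sub hi hint]
    refine Real.circleAverage_congr_sphere fun ζ hζ => ?_
    have := sub_ne_zero_of_mem_sphere_of_mem_ball hw (by simpa using hζ)
    simp only [herglotzRieszKernel, smul_eq_mul, sub_zero]
    field_simp
    ring
  have h3 : HasDerivAt (fun w => 2 * G w - G 0)
      (circleAverage (fun ζ => (2 * ζ / (ζ - z) ^ 2) • G ζ) 0 1) z :=
    h1.congr_of_eventuallyEq (by
      filter_upwards [isOpen_ball.mem_nhds hz] with w hw using (h2 w hw).symm)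
  have h4 := (h3.add_const (G 0)).const_mul (1 / 2 : ℂ)
  -- The correction term is holomorphic in `ζ`, its pole `1 / conj z` being outside the closed disc,
  -- and the factor `ζ` makes its mean value vanish.
  have h5 : circleAverage (fun ζ => ζ * (conj z ^ 2 / (1 - conj z * ζ) ^ 2) * G ζ) 0 1 = 0 := by
    have hd : DiffContOnCl ℂ (fun ζ => ζ * (conj z ^ 2 / (1 - conj z * ζ) ^ 2) * G ζ)
        (ball 0 |1|) := by
      rw [abs_one]
      refine DiffContOnCl.smul (𝕜' := ℂ) (DifferentiableOn.diffContOnCl ?_) hG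
      rw [closure_ball (0 : ℂ) one_ne_zero]
      have : ∀ ζ ∈ closedBall (0 : ℂ) 1, (1 - conj z * ζ) ^ 2 ≠ 0 := fun ζ hζ =>
        pow_ne_zero 2 (one_sub_conj_mul_ne_zero hz (by simpa using hζ))
      fun_prop (disch := assumption)
    simpa using hd.circleAverage
  have hi1 : CircleIntegrable (fun ζ => (1 / 2 : ℂ) • ((2 * ζ / (ζ - z) ^ 2) • G ζ)) 0 1 := by
    refine ContinuousOn.circleIntegrable zero_le_one ?_
    have : ∀ ζ ∈ sphere (0 : ℂ) 1, (ζ - z) ^ 2 ≠ 0 := fun ζ hζ =>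
      pow_ne_zero 2 (sub_ne_zero_of_mem_sphere_of_mem_ball hz hζ)
    fun_prop (disch := assumption)
  have hi2 : CircleIntegrable (fun ζ => ζ * (conj z ^ 2 / (1 - conj z * ζ) ^ 2) * G ζ) 0 1 := by
    refine ContinuousOn.circleIntegrable zero_le_one ?_
    have : ∀ ζ ∈ sphere (0 : ℂ) 1, (1 - conj z * ζ) ^ 2 ≠ 0 := fun ζ hζ =>
      pow_ne_zero 2 (one_sub_conj_mul_ne_zero hz (by
        rw [mem_sphere_zero_iff_norm] at hζ; exact hζ.le))
    fun_prop (disch := assumption)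
  have h6 : (fun w => 1 / 2 * (2 * G w - G 0 + G 0)) = G := by funext w; ring
  rw [h6] at h4
  refine h4.congr_deriv ?_
  rw [← smul_eq_mul (1 / 2 : ℂ), ← Real.circleAverage_fun_smul]
  refine ((sub_zero _).symm.trans (congrArg (fun t => _ - t) h5.symm)).trans ?_
  rw [← Real.circleAverage_fun_sub hi1 hi2]
  congr 1
  funext ζ
  simp only [derivKernel, smul_eq_mul]
  ring

/-- After `|ζ - ξ|` is replaced by `N |ζ - z|`, the linear term turns the kernel bound into a
multiple of the Poisson kernel, of mean `1`. The cubic term cancels the denominator and leaves a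
factor `1 - |z|²`, which is small near the circle. -/
theorem norm_deriv_le_of_norm_le_on_sphere {G : ℂ → ℂ}
    (hG : DiffContOnCl ℂ G (ball 0 1)) {ξ : ℂ} {ε C N : ℝ} (hε : 0 ≤ ε) (hC : 0 ≤ C)
    (hGb : ∀ ζ ∈ sphere (0 : ℂ) 1, ‖G ζ‖ ≤ ε * ‖ζ - ξ‖ + C * ‖ζ - ξ‖ ^ 3)
    {z : ℂ} (hz : z ∈ ball (0 : ℂ) 1)
    (hN : ∀ ζ ∈ sphere (0 : ℂ) 1, ‖ζ - ξ‖ ≤ N * ‖ζ - z‖) :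
    ‖deriv G z‖ ≤ 2 * N * ε + 2 * C * N ^ 3 * (1 - ‖z‖ ^ 2) := by
  have hz1 : ‖z‖ < 1 := by simpa using hz
  have hd : 0 ≤ 1 - ‖z‖ ^ 2 := by nlinarith [norm_nonneg z]
  have hi : CircleIntegrable (fun ζ : ℂ => (2 * N * ε) • ((1 - ‖z‖ ^ 2) / ‖ζ - z‖ ^ 2)) 0 1 := by
    refine ContinuousOn.circleIntegrable zero_le_one ?_
    have : ∀ ζ ∈ sphere (0 : ℂ) 1, ‖ζ - z‖ ^ 2 ≠ 0 := fun ζ hζ =>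
      pow_ne_zero 2 (norm_ne_zero_iff.2 (sub_ne_zero_of_mem_sphere_of_mem_ball hz hζ))
    fun_prop (disch := assumption)
  have hic : CircleIntegrable (fun _ : ℂ => 2 * C * N ^ 3 * (1 - ‖z‖ ^ 2)) 0 1 :=
    continuousOn_const.circleIntegrable zero_le_one
  rw [(hasDerivAt_circleAverage_derivKernel hG hz).deriv]
  refine (norm_circleAverage_le_of_norm_le (hi.add hic) ?_).trans_eq ?_
  · intro ζ hζ
    rw [abs_one] at hζ
    have hζ1 : ‖ζ‖ = 1 := by simpa using hζ
    have hp : 0 < ‖ζ - z‖ := norm_pos_iff.2 (sub_ne_zero_of_mem_sphere_of_mem_ball hz hζ)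
    rw [norm_mul, norm_mul, hζ1, one_mul, Pi.add_apply, smul_eq_mul]
    calc ‖derivKernel z ζ‖ * ‖G ζ‖
        ≤ (2 * (1 - ‖z‖ ^ 2) / ‖ζ - z‖ ^ 3) * (ε * (N * ‖ζ - z‖) + C * (N * ‖ζ - z‖) ^ 3) := by
          refine mul_le_mul (norm_derivKernel_le hz hζ) ((hGb ζ hζ).trans ?_) (norm_nonneg _)
            (by positivity)
          gcongr <;> exact hN ζ hζ
      _ = _ := by field_simp
  · rw [Real.circleAverage_add hi hic, Real.circleAverage_fun_smul,
      circleAverage_poissonKernel_eq_one hz, Real.circleAverage_const, smul_eq_mul, mul_one]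

/-! ### First-order behaviour at a boundary point. -/

theorem exists_norm_le_of_isLittleO_of_norm_le {G : ℂ → ℂ} {s : Set ℂ} {ξ : ℂ} {K : ℝ} (hK : 0 ≤ K)
    (hG : G =o[𝓝[s] ξ] fun ζ => ζ - ξ) (hGK : ∀ ζ ∈ s, ‖G ζ‖ ≤ K * ‖ζ - ξ‖) {ε : ℝ} (hε : 0 < ε) :
    ∃ C, 0 ≤ C ∧ ∀ ζ ∈ s, ‖G ζ‖ ≤ ε * ‖ζ - ξ‖ + C * ‖ζ - ξ‖ ^ 3 := by
  obtain ⟨η, hη, h⟩ := Metric.mem_nhdsWithin_iff.1 (hG.def hε)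
  -- Where `|ζ - ξ| ≥ η`, one has `|ζ - ξ| ≤ |ζ - ξ|³ / η²`, so the global linear bound is absorbed
  -- by the cubic term.
  refine ⟨K / η ^ 2, by positivity, fun ζ hζ => ?_⟩
  rcases lt_or_ge ‖ζ - ξ‖ η with h1 | h1
  · have h2 : ‖G ζ‖ ≤ ε * ‖ζ - ξ‖ := h ⟨by rwa [mem_ball, dist_eq_norm], hζ⟩
    have : 0 ≤ K / η ^ 2 * ‖ζ - ξ‖ ^ 3 := by positivity
    linarith
  · have h2 : K * ‖ζ - ξ‖ ≤ K / η ^ 2 * ‖ζ - ξ‖ ^ 3 := by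
      rw [div_mul_eq_mul_div, le_div_iff₀ (by positivity), mul_assoc, pow_succ' ‖ζ - ξ‖ 2]
      gcongr
    have h3 := hGK ζ hζ
    have : 0 ≤ ε * ‖ζ - ξ‖ := by positivity
    linarith

/-- Arc length and chord length are comparable near `ξ`, since `θ ↦ e^{iθ}` has nonzero derivative.
The local inverse `θ₀ + arg (ζ / ξ)` transfers the estimate from the line to the circle. -/
theorem isLittleO_of_hasDerivAt_comp_exp {G : ℂ → ℂ} {θ₀ : ℝ}
    (hG0 : G (Complex.exp (θ₀ * Complex.I)) = 0)
    (hG : HasDerivAt (fun θ : ℝ => G (Complex.exp (θ * Complex.I))) 0 θ₀) :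
    G =o[𝓝[sphere (0 : ℂ) 1] Complex.exp (θ₀ * Complex.I)]
      fun ζ => ζ - Complex.exp (θ₀ * Complex.I) := by
  set ξ := Complex.exp (θ₀ * Complex.I) with hξ
  have hξ0 : ξ ≠ 0 := Complex.exp_ne_zero _
  have h1 : (fun θ : ℝ => G (Complex.exp (θ * Complex.I))) =o[𝓝 θ₀] fun θ => θ - θ₀ := by
    have := hasDerivAt_iff_isLittleO.1 hG
    simpa [← hξ, hG0] using this
  have hexp : HasDerivAt (fun θ : ℝ => Complex.exp (θ * Complex.I)) (ξ * Complex.I) θ₀ := by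
    have h := ((hasDerivAt_id (θ₀ : ℂ)).mul_const Complex.I).cexp.comp_ofReal
    simpa using h
  have h2 : (fun θ : ℝ => θ - θ₀) =O[𝓝 θ₀] fun θ => Complex.exp (θ * Complex.I) - ξ :=
    (hexp.isTheta_sub (mul_ne_zero hξ0 Complex.I_ne_zero)).2.comp_tendsto
      (tendsto_id.prodMk (tendsto_const_pure (b := θ₀)))
  have h3 := h1.trans_isBigO h2
  have harg : Tendsto (fun ζ : ℂ => θ₀ + Complex.arg (ζ / ξ)) (𝓝[sphere (0 : ℂ) 1] ξ) (𝓝 θ₀) := by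
    have h4 : ContinuousAt (fun ζ : ℂ => θ₀ + Complex.arg (ζ / ξ)) ξ := by
      refine continuousAt_const.add (ContinuousAt.comp' ?_ (continuousAt_id.div_const ξ))
      rw [div_self hξ0]
      exact Complex.continuousAt_arg Complex.one_mem_slitPlane
    have h5 := h4.tendsto
    rw [div_self hξ0, Complex.arg_one, add_zero] at h5
    exact h5.mono_left nhdsWithin_le_nhds
  refine (h3.comp_tendsto harg).congr' ?_ ?_ <;>
  · filter_upwards [self_mem_nhdsWithin] with ζ hζ
    have hn : ‖ζ / ξ‖ = 1 := by
      rw [norm_div, mem_sphere_zero_iff_norm.1 hζ, hξ, Complex.norm_exp_ofReal_mul_I, div_one]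
    have h6 : Complex.exp ((θ₀ + Complex.arg (ζ / ξ) : ℝ) * Complex.I) = ζ := by
      have h7 := Complex.norm_mul_exp_arg_mul_I (ζ / ξ)
      rw [hn, Complex.ofReal_one, one_mul] at h7
      rw [Complex.ofReal_add, add_mul, Complex.exp_add, h7, ← hξ, mul_div_cancel₀ _ hξ0]
    simp only [Function.comp_apply, h6]

theorem tendsto_nontangential_of_differentiableAt_primitive {f F : ℂ → ℂ} {K : NNReal}
    (hF : LipschitzWith K F) (hFf : ∀ z ∈ ball (0 : ℂ) 1, HasDerivAt F (f z) z) {θ₀ : ℝ}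
    (hθ : DifferentiableAt ℝ (fun θ : ℝ => F (Complex.exp (θ * Complex.I))) θ₀) :
    ∃ L : ℂ, ∀ M : ℝ, 1 < M → Tendsto f (𝓝[{z | ‖z - Complex.exp (θ₀ * Complex.I)‖ <
      M * (1 - ‖z‖)}] Complex.exp (θ₀ * Complex.I)) (𝓝 L) := by
  set ξ := Complex.exp (θ₀ * Complex.I) with hξ
  have hξ0 : ξ ≠ 0 := Complex.exp_ne_zero _
  have hξ1 : ‖ξ‖ = 1 := Complex.norm_exp_ofReal_mul_I θ₀
  obtain ⟨c, hc⟩ : ∃ c, HasDerivAt (fun θ : ℝ => F (Complex.exp (θ * Complex.I))) c θ₀ :=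
    ⟨_, hθ.hasDerivAt⟩
  -- The tangential derivative divided by the velocity of `e^{iθ}`: the candidate for the boundary
  -- value of `F' = f`.
  set a : ℂ := c / (ξ * Complex.I) with ha
  refine ⟨a, fun M hM => ?_⟩
  set G : ℂ → ℂ := fun ζ => F ζ - F ξ - a * (ζ - ξ) with hGdef
  have hGd : ∀ z ∈ ball (0 : ℂ) 1, HasDerivAt G (f z - a) z := by
    intro z hz
    exact (((hFf z hz).sub_const (F ξ)).sub
      (((hasDerivAt_id z).sub_const ξ).const_mul a)).congr_deriv (by rw [mul_one])
  have hGc : DiffContOnCl ℂ G (ball 0 1) := by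
    refine ⟨fun z hz => (hGd z hz).differentiableAt.differentiableWithinAt, ?_⟩
    have := hF.continuous
    fun_prop
  have hexp : HasDerivAt (fun θ : ℝ => Complex.exp (θ * Complex.I)) (ξ * Complex.I) θ₀ := by
    have h := ((hasDerivAt_id (θ₀ : ℂ)).mul_const Complex.I).cexp.comp_ofReal
    simpa using h
  have hG' : HasDerivAt (fun θ : ℝ => G (Complex.exp (θ * Complex.I))) 0 θ₀ := by
    have := (hc.sub_const (F ξ)).sub ((hexp.sub_const ξ).const_mul a)
    rwa [ha, div_mul_cancel₀ _ (mul_ne_zero hξ0 Complex.I_ne_zero), sub_self] at this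
  have hGo := isLittleO_of_hasDerivAt_comp_exp (by simp [hGdef, ← hξ]) hG'
  have hGK : ∀ ζ ∈ sphere (0 : ℂ) 1, ‖G ζ‖ ≤ (K + ‖a‖) * ‖ζ - ξ‖ := by
    intro ζ _
    rw [add_mul, ← norm_mul]
    refine (norm_sub_le _ _).trans ?_
    gcongr
    exact hF.norm_sub_le ζ ξ
  rw [Metric.tendsto_nhds]
  intro e he
  -- In the approach region `|ζ - ξ| ≤ |ζ - z| + M (1 - |z|) ≤ (1 + M) |ζ - z|`.
  set N : ℝ := 1 + M with hN
  have hN0 : 0 < N := by linarith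
  -- This `ε` makes the linear contribution `2 N ε` equal to `e / 2`; the other half is left for the
  -- term that vanishes as `|z| → 1`.
  obtain ⟨C, hC, hCG⟩ := exists_norm_le_of_isLittleO_of_norm_le (by positivity) hGo hGK
    (ε := e / (4 * N)) (by positivity)
  have hlim : Tendsto (fun z : ℂ => 2 * C * N ^ 3 * (1 - ‖z‖ ^ 2)) (𝓝 ξ) (𝓝 0) := by
    have h : Continuous fun z : ℂ => 2 * C * N ^ 3 * (1 - ‖z‖ ^ 2) := by fun_prop
    simpa [hξ1] using h.tendsto ξ
  filter_upwards [self_mem_nhdsWithin,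
    nhdsWithin_le_nhds (hlim.eventually (gt_mem_nhds (half_pos he)))] with z hz hz2
  have hz' : ‖z - ξ‖ < M * (1 - ‖z‖) := hz
  have hz1 : ‖z‖ < 1 := by
    by_contra! h
    nlinarith [norm_nonneg (z - ξ)]
  have hzb : z ∈ ball (0 : ℂ) 1 := by simpa using hz1
  have h := norm_deriv_le_of_norm_le_on_sphere hGc (by positivity) hC hCG hzb (N := N) (by
    intro ζ hζ
    rw [mem_sphere_zero_iff_norm] at hζ
    have h1 : ‖ζ - ξ‖ ≤ ‖ζ - z‖ + ‖z - ξ‖ := norm_sub_le_norm_sub_add_norm_sub ζ z ξ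
    have h2 : 1 - ‖z‖ ≤ ‖ζ - z‖ := by rw [← hζ]; exact norm_sub_norm_le ζ z
    have h3 : M * (1 - ‖z‖) ≤ M * ‖ζ - z‖ := by gcongr
    rw [hN]
    linarith)
  rw [(hGd z hzb).deriv] at h
  have h5 : 2 * N * (e / (4 * N)) = e / 2 := by field_simp; norm_num
  rw [dist_eq_norm]
  linarith

/-- **Fatou's theorem**: a bounded holomorphic function on the unit disc has nontangential limits
almost everywhere on the unit circle. -/
theorem ae_exists_tendsto_nontangential {f : ℂ → ℂ} (hf : DifferentiableOn ℂ f (ball 0 1)) {B : ℝ}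
    (hB : ∀ z ∈ ball (0 : ℂ) 1, ‖f z‖ ≤ B) :
    ∀ᵐ θ : ℝ, ∃ L : ℂ, ∀ M : ℝ, 1 < M → Tendsto f (𝓝[{z | ‖z - Complex.exp (θ * Complex.I)‖ <
      M * (1 - ‖z‖)}] Complex.exp (θ * Complex.I)) (𝓝 L) := by
  -- The primitive is Lipschitz because its derivative is bounded on a convex set. A Lipschitz
  -- extension to the plane supplies its boundary values.
  obtain ⟨F₀, hF₀⟩ := hf.isExactOn_ball
  have hL : LipschitzOnWith B.toNNReal F₀ (ball 0 1) :=
    (convex_ball (0 : ℂ) 1).lipschitzOnWith_of_nnnorm_hasDerivWithin_le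
      (fun z hz => (hF₀ z hz).hasDerivWithinAt) fun z hz =>
        NNReal.coe_le_coe.1 ((hB z hz).trans (Real.le_coe_toNNReal B))
  obtain ⟨F, hF, hFF⟩ := hL.extend_finite_dimension
  have hFf : ∀ z ∈ ball (0 : ℂ) 1, HasDerivAt F (f z) z := fun z hz =>
    (hF₀ z hz).congr_of_eventuallyEq (by
      filter_upwards [isOpen_ball.mem_nhds hz] with w hw using (hFF hw).symm)
  have hexp : LipschitzWith 1 fun θ : ℝ => Complex.exp (θ * Complex.I) := by
    refine lipschitzWith_of_nnnorm_deriv_le (fun θ => by fun_prop) fun θ => ?_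
    have h := ((hasDerivAt_id (θ : ℂ)).mul_const Complex.I).cexp.comp_ofReal
    simp only [id] at h
    rw [h.deriv, ← NNReal.coe_le_coe]
    simp
  filter_upwards [(hF.comp hexp).ae_differentiableAt_real] with θ hθ
  exact tendsto_nontangential_of_differentiableAt_primitive hF hFf hθ

end Fatou

/-! ### Boundary values of zero-free bounded holomorphic functions -/

section ZeroFree

/-- Jensen's formula without zeros. Subtracting from `log B` makes the integrand nonnegative, as
Fatou's lemma needs; the bound does not depend on `r` at all. -/
theorem lintegral_log_sub_log_norm_circleMap {f : ℂ → ℂ} (hf : DifferentiableOn ℂ f (ball 0 1))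
    {B : ℝ} (hB : ∀ z ∈ ball (0 : ℂ) 1, ‖f z‖ ≤ B) (hf0 : ∀ z ∈ ball (0 : ℂ) 1, f z ≠ 0)
    {r : ℝ} (hr0 : 0 < r) (hr1 : r < 1) (a : ℝ) :
    ∫⁻ θ in Ioc a (a + 2 * Real.pi),
      ENNReal.ofReal (Real.log B - Real.log ‖f (circleMap 0 r θ)‖) =
    ENNReal.ofReal (2 * Real.pi * (Real.log B - Real.log ‖f 0‖)) := by
  have hsub : closedBall (0 : ℂ) |r| ⊆ ball 0 1 := by
    rw [abs_of_pos hr0]; exact closedBall_subset_ball hr1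
  have hmem : ∀ θ, circleMap 0 r θ ∈ ball (0 : ℂ) 1 := fun θ =>
    hsub (sphere_subset_closedBall (circleMap_mem_sphere' 0 r θ))
  have hJ := AnalyticOnNhd.circleAverage_log_norm_of_ne_zero (g := f) (c := 0) (R := r)
    (fun z hz => hf.analyticOnNhd isOpen_ball z (hsub hz)) fun z hz => hf0 z (hsub hz)
  have hcont : Continuous fun θ => Real.log ‖f (circleMap 0 r θ)‖ := by
    have h1 : Continuous fun θ => f (circleMap 0 r θ) :=
      hf.continuousOn.comp_continuous (continuous_circleMap 0 r) hmem
    exact h1.norm.log fun θ => norm_ne_zero_iff.2 (hf0 _ (hmem θ))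
  have hper : Function.Periodic (fun θ : ℝ => Real.log ‖f (circleMap 0 r θ)‖) (2 * Real.pi) := by
    intro θ; simp only [periodic_circleMap 0 r θ]
  have h2 : ∫ θ in a..a + 2 * Real.pi, Real.log ‖f (circleMap 0 r θ)‖
      = 2 * Real.pi * Real.log ‖f 0‖ := by
    rw [← hJ, Real.circleAverage_def, smul_eq_mul, mul_inv_cancel_left₀ Real.two_pi_pos.ne',
      hper.intervalIntegral_add_eq a 0, zero_add]
  have h3 : ∫ θ in a..a + 2 * Real.pi, (Real.log B - Real.log ‖f (circleMap 0 r θ)‖)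
      = 2 * Real.pi * (Real.log B - Real.log ‖f 0‖) := by
    rw [intervalIntegral.integral_sub (by simp) (hcont.intervalIntegrable _ _), h2]
    simp
    ring
  rw [← h3, intervalIntegral.integral_of_le (by linarith [Real.pi_pos]),
    ofReal_integral_eq_lintegral_ofReal]
  · exact ((continuous_const.sub hcont).intervalIntegrable _ _).1
  · refine ae_of_all _ fun θ => ?_
    have h4 := Real.log_le_log (norm_pos_iff.2 (hf0 _ (hmem θ))) (hB _ (hmem θ))
    simpa using h4

/-- The radial limits of a zero-free bounded holomorphic function on the unit disc are nonzero
almost everywhere. -/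
theorem ae_not_tendsto_zero_of_ne_zero {f : ℂ → ℂ} (hf : DifferentiableOn ℂ f (ball 0 1))
    {B : ℝ} (hB : ∀ z ∈ ball (0 : ℂ) 1, ‖f z‖ ≤ B) (hf0 : ∀ z ∈ ball (0 : ℂ) 1, f z ≠ 0)
    {r : ℕ → ℝ} (hr0 : ∀ n, 0 < r n) (hr1 : ∀ n, r n < 1) :
    ∀ᵐ θ : ℝ, ¬ Tendsto (fun n => f (circleMap 0 (r n) θ)) atTop (𝓝 0) := by
  set u : ℕ → ℝ → ENNReal := fun n θ =>
    ENNReal.ofReal (Real.log B - Real.log ‖f (circleMap 0 (r n) θ)‖) with hu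
  have hmem : ∀ n θ, circleMap 0 (r n) θ ∈ ball (0 : ℂ) 1 := fun n θ =>
    closedBall_subset_ball (hr1 n) (circleMap_mem_closedBall 0 (hr0 n).le θ)
  have hmeas : ∀ n, Measurable (u n) := by
    intro n
    have h1 : Continuous fun θ => f (circleMap 0 (r n) θ) :=
      hf.continuousOn.comp_continuous (continuous_circleMap 0 (r n)) (hmem n)
    exact (measurable_const.sub (Real.measurable_log.comp h1.norm.measurable)).ennreal_ofReal
  have hmain : ∀ a : ℝ, ∀ᵐ θ ∂(volume.restrict (Ioc a (a + 2 * Real.pi))),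
      ¬ Tendsto (fun n => f (circleMap 0 (r n) θ)) atTop (𝓝 0) := by
    intro a
    -- Fatou's lemma: the integrals along the sequence of radii are one finite constant, so the
    -- lower limit is finite almost everywhere.
    have h1 : ∫⁻ θ in Ioc a (a + 2 * Real.pi), liminf (fun n => u n θ) atTop ≠ ⊤ := by
      refine ne_top_of_le_ne_top ?_ (lintegral_liminf_le hmeas)
      simp only [hu, lintegral_log_sub_log_norm_circleMap hf hB hf0 (hr0 _) (hr1 _), liminf_const]
      exact ENNReal.ofReal_ne_top
    filter_upwards [ae_lt_top (Measurable.liminf hmeas) h1] with θ hθ hlim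
    have h2 : Tendsto (fun n => u n θ) atTop (𝓝 ⊤) := by
      refine ENNReal.tendsto_ofReal_nhds_top.2 ?_
      have h3 : Tendsto (fun n => ‖f (circleMap 0 (r n) θ)‖) atTop (𝓝[≠] 0) := by
        refine tendsto_nhdsWithin_iff.2 ⟨by simpa using hlim.norm, ?_⟩
        exact Eventually.of_forall fun n => norm_ne_zero_iff.2 (hf0 _ (hmem n θ))
      have h4 := tendsto_neg_atBot_atTop.comp (Real.tendsto_log_nhdsNE_zero.comp h3)
      simpa [sub_eq_add_neg] using tendsto_atTop_add_const_left atTop (Real.log B) h4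
    rw [h2.liminf_eq] at hθ
    exact lt_irrefl _ hθ
  -- The line is a countable union of periods.
  rw [← Measure.restrict_univ (μ := (volume : Measure ℝ)),
    ← iUnion_Ioc_add_zsmul Real.two_pi_pos 0, ae_restrict_iUnion_iff]
  intro n
  have h := hmain (0 + n • (2 * Real.pi))
  rwa [add_assoc, ← add_one_zsmul] at h

end ZeroFree

/-! ### Multipliers of sub-Bergman spaces -/

section Multipliers

/-- In polar coordinates the mass is governed by `∫ y (1 - y²)^α` over `(0, 1)`, where `(1 - y)^α`
is integrable because `α > -1`. This places the constants in `A²_α`. -/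
theorem isFiniteMeasure_bergmanMeasure {α : ℝ} (hα : -1 < α) :
    IsFiniteMeasure (bergmanMeasure α) := by
  have h1 : IntegrableOn (fun y : ℝ => (1 - y) ^ α) (Ioo 0 1) := by
    have h := (intervalIntegral.intervalIntegrable_rpow' (a := 0) (b := 1) hα).comp_sub_left 1
    rw [sub_zero, sub_self] at h
    exact h.symm.1.mono_set Ioo_subset_Ioc_self
  have h2 : IntegrableOn (fun y : ℝ => y * (1 - y ^ 2) ^ α) (Ioo 0 1) := by
    refine (h1.const_mul (2 ^ |α|)).mono' (by fun_prop) ?_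
    filter_upwards [ae_restrict_mem measurableSet_Ioo] with y hy
    have hy1 : 0 < 1 - y := by linarith [hy.2]
    -- The exponent `|α|` covers both signs of `α`, as `1 ≤ 1 + y ≤ 2`.
    have h3 : (1 + y) ^ α ≤ 2 ^ |α| :=
      (Real.rpow_le_rpow_of_exponent_le (by linarith [hy.1]) (le_abs_self α)).trans
        (Real.rpow_le_rpow (by linarith [hy.1]) (by linarith [hy.2]) (abs_nonneg α))
    rw [show 1 - y ^ 2 = (1 + y) * (1 - y) by ring,
      Real.mul_rpow (by linarith [hy.1]) hy1.le, Real.norm_of_nonneg (by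
        have := hy.1
        positivity)]
    calc y * ((1 + y) ^ α * (1 - y) ^ α) ≤ 1 * (2 ^ |α| * (1 - y) ^ α) := by
          have h0 := hy.1
          gcongr
          exact hy.2.le
      _ = _ := one_mul _
  have h4 : Integrable (fun z : ℂ => (Iio 1).indicator (fun y : ℝ => (1 - y ^ 2) ^ α) ‖z‖) := by
    rw [integrable_fun_norm_addHaar, Complex.finrank_real_complex]
    have h5 : (fun y : ℝ => y ^ (2 - 1) • (Iio 1).indicator (fun y : ℝ => (1 - y ^ 2) ^ α) y) =
        (Iio 1).indicator fun y : ℝ => y * (1 - y ^ 2) ^ α := by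
      funext y
      by_cases hy : y ∈ Iio (1 : ℝ) <;> simp [hy]
    rw [h5, IntegrableOn, integrable_indicator_iff measurableSet_Iio, IntegrableOn,
      Measure.restrict_restrict measurableSet_Iio, inter_comm, Ioi_inter_Iio]
    exact h2
  refine isFiniteMeasure_withDensity (ne_of_lt ?_)
  refine lt_of_le_of_lt ?_ h4.hasFiniteIntegral
  rw [← lintegral_indicator measurableSet_ball]
  refine lintegral_mono fun z => ?_
  by_cases hz : ‖z‖ < 1
  · beta_reduce
    rw [indicator_of_mem (by simpa using hz), show (Iio 1).indicator (fun y : ℝ => (1 - y ^ 2) ^ α) ‖z‖ = (1 - ‖z‖ ^ 2) ^ α from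
      indicator_of_mem (by exact hz) _]
    exact Real.ofReal_le_enorm _
  · rw [indicator_of_notMem (by simpa using hz)]
    exact zero_le

theorem exists_bergman_apply_ne_zero {α : ℝ} (hα : -1 < α) (z : 𝔻) :
    ∃ g : Bergman α, g z ≠ 0 := by
  have := isFiniteMeasure_bergmanMeasure hα
  have hhol : IsHolomorphicDisc (1 : 𝔻 → ℂ) := by
    refine (differentiableOn_const (1 : ℂ)).congr fun w hw => ?_
    rw [extendDisc_mk _ (by simpa using hw)]
    rfl
  have hint : Integrable (fun w => ‖extendDisc (1 : 𝔻 → ℂ) w‖ ^ 2) (bergmanMeasure α) := by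
    refine (integrable_const (1 : ℝ)).mono' ?_ (ae_of_all _ fun w => ?_)
    · exact (hhol.aestronglyMeasurable α).norm.pow 2
    · by_cases h : ‖w‖ < 1 <;> simp [extendDisc, h]
  let g : Bergman α := ⟨1, hhol, hint⟩
  refine ⟨g, ?_⟩
  change (1 : ℂ) ≠ 0
  exact one_ne_zero

/-! ### Multipliers and kernel functions in a general reproducing kernel Hilbert space. -/

section RKHS

variable {H : Type*} [NormedAddCommGroup H] [InnerProductSpace ℂ H] [RKHS ℂ H 𝔻 ℂ]

/-- Vanishing at `z` is a closed condition; if `ψ z = 0`, it would pass from `ψ H` to all of `H`. -/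
theorem ne_zero_of_dense_mul {ψ : 𝔻 → ℂ} (hψ : Dense {g : H | ∃ h : H, (g : 𝔻 → ℂ) = ψ * h})
    {z : 𝔻} (hz : ∃ g : H, g z ≠ 0) : ψ z ≠ 0 := by
  intro h0
  obtain ⟨g, hg⟩ := hz
  have hc : IsClosed {g : H | g z = 0} := isClosed_eq (RKHS.continuous_eval z) continuous_const
  refine hg (hc.closure_subset_iff.2 ?_ (hψ g))
  rintro u ⟨h, hu⟩
  change u z = 0
  rw [hu, Pi.mul_apply, h0, zero_mul]

variable [CompleteSpace H]

theorem inner_kerFun_one (z : 𝔻) (g : H) : ⟪RKHS.kerFun H z (1 : ℂ), g⟫_ℂ = g z := by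
  rw [RKHS.kerFun_inner]
  simp

theorem kerFun_one_ne_zero {z : 𝔻} (hz : ∃ g : H, g z ≠ 0) : RKHS.kerFun H z (1 : ℂ) ≠ 0 := by
  obtain ⟨g, hg⟩ := hz
  intro h
  apply hg
  rw [← inner_kerFun_one, h, inner_zero_left]

/-- Cauchy–Schwarz for `⟪k, φ k⟫ = φ z * ‖k‖²`, with `k` the kernel at `z`, which is nonzero by
`hz`. -/
theorem norm_mult_apply_le {φ : 𝔻 → ℂ} (hφ : φ ∈ Mult H) {z : 𝔻} (hz : ∃ g : H, g z ≠ 0) :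
    ‖φ z‖ ≤ ‖multiplicationOperator φ hφ‖ := by
  set k := RKHS.kerFun H z (1 : ℂ) with hk
  have hk0 : 0 < ‖k‖ := norm_pos_iff.2 (kerFun_one_ne_zero hz)
  have h1 : ⟪k, multiplicationOperator φ hφ k⟫_ℂ = φ z * ⟪k, k⟫_ℂ := by
    rw [hk, inner_kerFun_one, inner_kerFun_one, multiplicationOperator_apply]
  have h2 := norm_inner_le_norm (𝕜 := ℂ) k (multiplicationOperator φ hφ k)
  rw [h1, norm_mul, inner_self_eq_norm_sq_to_K, norm_pow, RCLike.norm_ofReal,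
    abs_of_pos hk0] at h2
  have h3 := (multiplicationOperator φ hφ).le_opNorm k
  have h4 : ‖φ z‖ * ‖k‖ ^ 2 ≤ ‖multiplicationOperator φ hφ‖ * ‖k‖ ^ 2 := by
    refine h2.trans ?_
    nlinarith
  exact le_of_mul_le_mul_right h4 (by positivity)

theorem adjoint_multiplicationOperator_kerFun {φ : 𝔻 → ℂ} (hφ : φ ∈ Mult H) (z : 𝔻) :
    ContinuousLinearMap.adjoint (multiplicationOperator φ hφ) (RKHS.kerFun H z (1 : ℂ)) =
      conj (φ z) • RKHS.kerFun H z (1 : ℂ) := by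
  refine ext_inner_right ℂ fun g => ?_
  rw [ContinuousLinearMap.adjoint_inner_left, inner_smul_left, inner_kerFun_one, inner_kerFun_one,
    multiplicationOperator_apply, Complex.conj_conj]

end RKHS

/-! ### Nonvanishing of point evaluations on the sub-Bergman space. -/

theorem defectOperator_mul_self {E : Type*} [NormedAddCommGroup E] [InnerProductSpace ℂ E]
    [CompleteSpace E] {T : E →L[ℂ] E} (hT : ‖T‖ ≤ 1) :
    defectOperator T * defectOperator T = 1 - T * ContinuousLinearMap.adjoint T := by
  -- Contractivity enters here: `CFC.sqrt` squares back to its argument because `1 - T T*` is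
  -- nonnegative.
  refine CFC.sqrt_mul_sqrt_self _ (sub_nonneg.2 ?_)
  have h0 : 0 ≤ T * star T := mul_star_self_nonneg T
  refine (CStarAlgebra.norm_le_one_iff_of_nonneg _ h0).1 ?_
  rw [CStarRing.norm_self_mul_star]
  exact mul_le_one₀ hT (norm_nonneg _) hT

/-- The multiplier bound gives `|φ| ≤ 1`; equality at an interior point would make `φ` a unimodular
constant by the maximum modulus principle. -/
theorem norm_lt_one_of_toeplitz_norm_le_one {α : ℝ} (hα : -1 < α) {φ : 𝔻 → ℂ}
    (hφ : φ ∈ Mult (Bergman α)) (hφ1 : ‖toeplitz α φ hφ‖ ≤ 1)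
    (hφ2 : ¬ ∃ c : ℂ, ‖c‖ = 1 ∧ ∀ z : 𝔻, φ z = c) (z : 𝔻) : ‖φ z‖ < 1 := by
  have hle : ∀ w, ‖φ w‖ ≤ 1 := fun w =>
    (norm_mult_apply_le hφ (exists_bergman_apply_ne_zero hα w)).trans hφ1
  refine lt_of_le_of_ne (hle z) fun h1 => hφ2 ⟨φ z, h1, fun w => ?_⟩
  have hmax : IsMaxOn (norm ∘ extendDisc φ) (ball 0 1) (z : ℂ) := by
    intro w hw
    change ‖extendDisc φ w‖ ≤ ‖extendDisc φ (z : ℂ)‖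
    rw [extendDisc_coe, h1, extendDisc_mk _ (by simpa using hw)]
    exact hle _
  have h2 := Complex.eqOn_of_isPreconnected_of_isMaxOn_norm (convex_ball (0 : ℂ) 1).isPreconnected
    isOpen_ball hφ.1 (by simpa using z.norm_lt_one) hmax
    (show (w : ℂ) ∈ ball (0 : ℂ) 1 by simpa using w.norm_lt_one)
  simpa using h2

/-- The witness is `D² k`, with `k` the Bergman kernel at `z`: it lies in the range of `D`, and
squaring removes the root, so its value at `z` is explicit. -/
theorem exists_subBergman_apply_ne_zero {α : ℝ} (hα : -1 < α) {φ : 𝔻 → ℂ}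
    (hφ : φ ∈ Mult (Bergman α)) (hφ1 : ‖toeplitz α φ hφ‖ ≤ 1)
    (hφ2 : ¬ ∃ c : ℂ, ‖c‖ = 1 ∧ ∀ z : 𝔻, φ z = c) (z : 𝔻) :
    ∃ g : SubBergman α φ hφ, g z ≠ 0 := by
  set D := defectOperator (toeplitz α φ hφ) with hD
  set k := RKHS.kerFun (Bergman α) z (1 : ℂ) with hk
  have hk0 : 0 < ‖k‖ := norm_pos_iff.2 (kerFun_one_ne_zero (exists_bergman_apply_ne_zero hα z))
  refine ⟨OperatorRange.proj D (D k), ?_⟩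
  change (D (D k)) z ≠ 0
  have h1 : D (D k) = k - toeplitz α φ hφ (conj (φ z) • k) := by
    have := congrArg (fun A => A k) (defectOperator_mul_self hφ1)
    simp only [mul_apply_eq_comp, sub_apply, one_apply_eq_self] at this
    rw [hk, adjoint_multiplicationOperator_kerFun] at this
    exact this
  have h2 : k z = ((‖k‖ ^ 2 : ℝ) : ℂ) := by
    rw [← inner_kerFun_one, ← hk, inner_self_eq_norm_sq_to_K]
    norm_cast
  have h3 : (D (D k)) z = (((1 - ‖φ z‖ ^ 2) * ‖k‖ ^ 2 : ℝ) : ℂ) := by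
    have h4 : φ z * conj (φ z) = ((‖φ z‖ ^ 2 : ℝ) : ℂ) := by
      rw [Complex.mul_conj, Complex.normSq_eq_norm_sq]
    rw [h1, RKHS.coe_sub, Pi.sub_apply, multiplicationOperator_apply, RKHS.coe_smul, Pi.smul_apply,
      smul_eq_mul, ← mul_assoc, h4, h2]
    push_cast
    ring
  have h5 := norm_lt_one_of_toeplitz_norm_le_one hα hφ hφ1 hφ2 z
  have h6 : 0 < 1 - ‖φ z‖ ^ 2 := by nlinarith [norm_nonneg (φ z)]
  rw [h3]
  exact_mod_cast (by positivity : (1 - ‖φ z‖ ^ 2) * ‖k‖ ^ 2 ≠ 0)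

end Multipliers

/-! ### Nontangential limits -/

theorem tendsto_approachRegion {g : 𝔻 → ℂ} {ξ L : ℂ} {M : ℝ}
    (h : Tendsto (extendDisc g) (𝓝[{z | ‖z - ξ‖ < M * (1 - ‖z‖)}] ξ) (𝓝 L)) :
    Tendsto g (comap (fun z : 𝔻 => (z : ℂ)) (𝓝 ξ) ⊓ 𝓟 (approachRegion ξ M)) (𝓝 L) := by
  have h1 : Tendsto (fun z : 𝔻 => (z : ℂ)) (comap (fun z : 𝔻 => (z : ℂ)) (𝓝 ξ) ⊓
      𝓟 (approachRegion ξ M)) (𝓝[{z | ‖z - ξ‖ < M * (1 - ‖z‖)}] ξ) :=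
    tendsto_inf.2 ⟨tendsto_comap.mono_left inf_le_left,
      tendsto_principal.2 (mem_inf_of_right fun _ hz => hz)⟩
  exact (h.comp h1).congr fun z => extendDisc_coe g z

/-- A radius lies in every approach region, since `|rξ - ξ| = 1 - r < M (1 - r)`. This links the
radial nonvanishing result to non-tangential limits. -/
theorem tendsto_circleMap_approachRegion {r : ℕ → ℝ} (hr0 : ∀ n, 0 < r n) (hr1 : ∀ n, r n < 1)
    (hr : Tendsto r atTop (𝓝 1)) {M : ℝ} (hM : 1 < M) (θ : ℝ) :
    Tendsto (fun n => circleMap 0 (r n) θ) atTop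
      (𝓝[{z | ‖z - Complex.exp (θ * Complex.I)‖ < M * (1 - ‖z‖)}]
        Complex.exp (θ * Complex.I)) := by
  refine tendsto_nhdsWithin_iff.2 ⟨?_, Eventually.of_forall fun n => ?_⟩
  · have h := ((Complex.continuous_ofReal.tendsto 1).comp hr).mul_const
      (Complex.exp (θ * Complex.I))
    simpa [circleMap] using h
  · have h1 : circleMap 0 (r n) θ - Complex.exp (θ * Complex.I) =
        ((r n - 1 : ℝ) : ℂ) * Complex.exp (θ * Complex.I) := by
      simp [circleMap]; ring
    have h2 : ‖circleMap 0 (r n) θ‖ = r n := by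
      rw [norm_circleMap_zero, abs_of_pos (hr0 n)]
    have h3 := hr1 n
    rw [mem_ofPred_eq, h1, h2, norm_mul, Complex.norm_exp_ofReal_mul_I, mul_one, Complex.norm_real,
      Real.norm_eq_abs, abs_of_neg (by linarith)]
    nlinarith

theorem theorem2 (α : ℝ) (hα : -1 < α)
    (φ : 𝔻 → ℂ) (hφ : φ ∈ Mult (Bergman α)) (hφ1 : ‖toeplitz α φ hφ‖ ≤ 1)
    (hφ2 : ¬ ∃ c : ℂ, ‖c‖ = 1 ∧ ∀ z : 𝔻, φ z = c)
    (f : 𝔻 → ℂ) (hf : f ∈ smirnovClass (SubBergman α φ hφ)) :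
    ∀ᵐ θ : ℝ, ∃ L : ℂ, HasNontangentialLimit f (Complex.exp (θ * Complex.I)) L := by
  obtain ⟨γ, hγ, ψ, hψ, hdense, rfl⟩ := hf
  have hne := exists_subBergman_apply_ne_zero hα hφ hφ1 hφ2
  have hbdd : ∀ {χ : 𝔻 → ℂ}, χ ∈ Mult (SubBergman α φ hφ) →
      ∃ B, ∀ z ∈ ball (0 : ℂ) 1, ‖extendDisc χ z‖ ≤ B := fun {χ} hχ =>
    ⟨_, fun z hz => by
      rw [extendDisc_mk _ (by simpa using hz)]
      exact norm_mult_apply_le hχ (hne _)⟩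
  obtain ⟨B, hB⟩ := hbdd hγ
  obtain ⟨B', hB'⟩ := hbdd hψ
  have hψ0 : ∀ z ∈ ball (0 : ℂ) 1, extendDisc ψ z ≠ 0 := fun z hz => by
    rw [extendDisc_mk _ (by simpa using hz)]
    exact ne_zero_of_dense_mul hdense (hne _)
  have hr0 : ∀ n : ℕ, (0 : ℝ) < 1 - 1 / ((n : ℝ) + 2) := fun n => by
    rw [sub_pos, div_lt_one (by positivity)]
    linarith [(Nat.cast_nonneg n : (0 : ℝ) ≤ n)]
  have hr1 : ∀ n : ℕ, 1 - 1 / ((n : ℝ) + 2) < 1 := fun n =>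
    sub_lt_self _ (by positivity)
  have hr : Tendsto (fun n : ℕ => 1 - 1 / ((n : ℝ) + 2)) atTop (𝓝 1) := by
    have h : Tendsto (fun n : ℕ => 1 / ((n : ℝ) + 2)) atTop (𝓝 0) :=
      tendsto_const_nhds.div_atTop
        (tendsto_atTop_add_const_right _ _ tendsto_natCast_atTop_atTop)
    simpa using h.const_sub 1
  filter_upwards [ae_exists_tendsto_nontangential hγ.1 hB, ae_exists_tendsto_nontangential hψ.1 hB',
    ae_not_tendsto_zero_of_ne_zero hψ.1 hB' hψ0 hr0 hr1] with θ ⟨L, hL⟩ ⟨L', hL'⟩ h0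
  -- The radial limit of `ψ` equals its non-tangential limit, so `L' = 0` is excluded; any aperture
  -- above `1` would serve in place of `2`.
  have hL0 : L' ≠ 0 := by
    rintro rfl
    exact h0 ((hL' 2 one_lt_two).comp (tendsto_circleMap_approachRegion hr0 hr1 hr one_lt_two θ))
  exact ⟨L / L', fun M hM => (tendsto_approachRegion (hL M hM)).div
    (tendsto_approachRegion (hL' M hM)) hL0⟩
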